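/- Let $\Phi$ be a homogeneous Poisson point process on $\mathbb{R}^2$ of intensity $\lambda>0$. A configuration is a locally finite counting measure on $\mathbb{R}^2$, i.e. a countable collection of points (agents), repetitions allowed, of which only finitely many lie in each bounded set; the space of configurations carries the $\sigma$-algebra generated by the maps $\varphi\mapsto\varphi(B)$, $B$ Borel, and the shifts $\theta_t$ given by $(\theta_t\varphi)(B)=\varphi(B+t)$. One step of the follower dynamics moves all agents of a configuration simultaneously: each agent moves to the midpoint between its position and the position of its leader, which is the closest among the other agents (agents at the same position are at distance $0$; ties between different positions are broken by the lexicographic order of $\mathbb{R}^2$; an agent without any other agent stays where it is). Let $\Phi_n$ be the follower point process of order $n$, obtained from $\Phi_0=\Phi$ by $n$ steps of this dynamics. Then for every $n\ge 0$: 1. $\Phi_n$ is a translation-equivariant factor of $\Phi$: there is a measurable map $F$ from the space of configurations to itself such that $F(\theta_t\varphi)=\theta_t F(\varphi)$ for all $t\in\mathbb{R}^2$ and all configurations $\varphi$, and $\Phi_n=F(\Phi)$ almost surely. 2. $\Phi_n$ is a stationary and mixing point process: it is measurable, its law $\mathbb{P}_n$ on the space of configurations is invariant under the measurable flow $(\theta_t)_{t\in\mathbb{R}^2}$,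 and for all measurable sets $A_1,A_2$ of configurations, $$\lim_{|x|\to\infty}\mathbb{P}_n(A_1\cap\theta_{-x}A_2)=\mathbb{P}_n(A_1)\,\mathbb{P}_n(A_2).$$ -/

import Mathlib

open MeasureTheory Filter Topology

noncomputable section

namespace FollowerDynamics

/-- The Euclidean plane. -/
abbrev Plane : Type := EuclideanSpace ℝ (Fin 2)

/-- `μ` is a locally finite counting measure `∑ i, δ_{s i}`: a countable collection of points,
possibly with repetitions, of which only finitely many lie in any bounded set. -/
def IsCounting (μ : Measure Plane) : Prop :=
  ∃ (ι : Type) (_ : Countable ι) (s : ι → Plane),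
    (∀ B : Set Plane, Bornology.IsBounded B → {i | s i ∈ B}.Finite) ∧
      μ = Measure.sum fun i => Measure.dirac (s i)

/-- The space of locally finite counting measures on the plane. Its σ-algebra is the one induced
from `Measure Plane`, generated by the maps `φ ↦ φ B` with `B` Borel. -/
def Config : Type := {μ : Measure Plane // IsCounting μ}

instance : MeasurableSpace Config := inferInstanceAs (MeasurableSpace {μ // IsCounting μ})

/-- The counting measure underlying a configuration. -/
def Config.toMeasure (φ : Config) : Measure Plane := φ.1

/-- The opinions of the agents of `μ` other than one given agent with opinion `x`, that is, the
atoms of `μ - δ_x`. The point `x` itself is one of them if at least two agents are located at `x`. -/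
def others (μ : Measure Plane) (x : Plane) : Set Plane :=
  {y | μ {y} ≠ 0 ∧ (y = x → 2 ≤ μ {x})}

/-- `y` is closer to `x` than `z`, or equally close and not after `z` in lexicographic order. -/
def PrecedesFrom (x y z : Plane) : Prop :=
  dist x y < dist x z ∨
    (dist x y = dist x z ∧ (y 0 < z 0 ∨ (y 0 = z 0 ∧ y 1 ≤ z 1)))

/-- An agent with opinion `x` follows an agent with opinion `y`: `y` is the opinion closest to `x`
among those of the other agents, ties between different opinions being broken
lexicographically. -/
def Follows (μ : Measure Plane) (x y : Plane) : Prop :=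
  y ∈ others μ x ∧ ∀ z ∈ others μ x, PrecedesFrom x y z

open Classical in
/-- The opinion of the leader of an agent with opinion `x` (`x` itself if there is no other
agent). -/
def leader (μ : Measure Plane) (x : Plane) : Plane :=
  if h : ∃ y, Follows μ x y then h.choose else x

/-- The new opinion of an agent with opinion `x`: halfway to its leader. -/
def move (μ : Measure Plane) (x : Plane) : Plane := midpoint ℝ x (leader μ x)

theorem PrecedesFrom.dist_le {x y z : Plane} (h : PrecedesFrom x y z) : dist x y ≤ dist x z := by
  rcases h with h | h
  · exact h.le
  · exact h.1.le

theorem IsCounting.aemeasurable {μ : Measure Plane} (h : IsCounting μ) (f : Plane → Plane) :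
    AEMeasurable f μ := by
  obtain ⟨ι, hι, s, -, rfl⟩ := h
  exact aemeasurable_sum_measure_iff.2 fun i => aemeasurable_dirac

theorem map_sum_dirac {ι : Type} [Countable ι] (s : ι → Plane) (f : Plane → Plane) :
    (Measure.sum fun i => Measure.dirac (s i)).map f =
      Measure.sum fun i => Measure.dirac (f (s i)) := by
  rw [Measure.map_sum (aemeasurable_sum_measure_iff.2 fun i => aemeasurable_dirac)]
  congr 1
  funext i
  ext B hB
  rw [Measure.map_apply_of_aemeasurable aemeasurable_dirac hB, Measure.dirac_apply' _ hB,
    Measure.dirac_apply]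
  rfl

theorem mem_others {ι : Type} (s : ι → Plane) {i j : ι} (hij : i ≠ j) :
    s j ∈ others (Measure.sum fun i => Measure.dirac (s i)) (s i) := by
  classical
  have key : ∀ x : Plane, (Measure.sum fun i => Measure.dirac (s i)) {x} =
      ∑' k, if s k = x then 1 else 0 := by
    intro x
    rw [Measure.sum_apply _ (measurableSet_singleton x)]
    congr 1
    funext k
    rw [Measure.dirac_apply]
    simp [Set.indicator_apply]
  refine ⟨?_, fun h => ?_⟩
  · rw [key]
    intro h0
    have := ENNReal.tsum_eq_zero.1 h0 j
    simp at this
  · rw [key]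
    refine le_trans ?_ (ENNReal.sum_le_tsum {i, j})
    rw [Finset.sum_pair hij]
    simp [h, one_add_one_eq_two]

theorem IsCounting.map_move {μ : Measure Plane} (h : IsCounting μ) :
    IsCounting (μ.map (move μ)) := by
  obtain ⟨ι, hι, s, hs, rfl⟩ := h
  set μ := Measure.sum fun i => Measure.dirac (s i) with hμ
  refine ⟨ι, hι, fun i => move μ (s i), fun B hB => ?_, map_sum_dirac s _⟩
  rcases isEmpty_or_nonempty ι with he | ⟨⟨i₀⟩⟩
  · exact Set.toFinite _
  obtain ⟨r, hr⟩ := hB.subset_closedBall 0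
  have hfin := (hs (Metric.closedBall 0 (max r (2 * r + ‖s i₀‖)))
    Metric.isBounded_closedBall).union (Set.finite_singleton i₀)
  refine hfin.subset fun i hi => ?_
  by_cases hii : i = i₀
  · exact Or.inr hii
  refine Or.inl ?_
  have hm : ‖move μ (s i)‖ ≤ r := by simpa using hr hi
  show s i ∈ Metric.closedBall 0 _
  rw [mem_closedBall_zero_iff]
  by_cases hex : ∃ y, Follows μ (s i) y
  · have hd : dist (s i) (leader μ (s i)) ≤ dist (s i) (s i₀) := by
      rw [leader, dif_pos hex]
      exact (hex.choose_spec.2 _ (mem_others s hii)).dist_le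
    have h1 : dist (s i) (move μ (s i)) = 1 / 2 * dist (s i) (leader μ (s i)) := by
      rw [move, dist_left_midpoint]
      norm_num
    have h2 : dist (s i) (s i₀) ≤ ‖s i‖ + ‖s i₀‖ := dist_le_norm_add_norm _ _
    have h3 : ‖s i‖ ≤ dist (s i) (move μ (s i)) + ‖move μ (s i)‖ := by
      rw [dist_eq_norm]
      simpa using norm_add_le (s i - move μ (s i)) (move μ (s i))
    exact le_max_of_le_right (by linarith)
  · have : move μ (s i) = s i := by
      rw [move, leader, dif_neg hex, midpoint_self]
    rw [this] at hm
    exact le_max_of_le_left hm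

theorem IsCounting.map_sub {μ : Measure Plane} (h : IsCounting μ) (t : Plane) :
    IsCounting (μ.map fun x => x - t) := by
  obtain ⟨ι, hι, s, hs, rfl⟩ := h
  refine ⟨ι, hι, fun i => s i - t, fun B hB => ?_, map_sum_dirac s _⟩
  obtain ⟨r, hr⟩ := hB.subset_closedBall 0
  refine (hs (Metric.closedBall t r) Metric.isBounded_closedBall).subset fun i hi => ?_
  simpa [dist_eq_norm] using hr hi

/-- One step of the follower dynamics: all agents simultaneously move halfway to their leaders. -/
def followerStep (φ : Config) : Config := ⟨φ.toMeasure.map (move φ.toMeasure), φ.2.map_move⟩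

/-- The spatial shift: `(shift t φ) B = φ (B + t)`. -/
def shift (t : Plane) (φ : Config) : Config := ⟨φ.toMeasure.map fun x => x - t, φ.2.map_sub t⟩

/-- The follower point process of order `n` started from the point process `Φ`. -/
def followerProcess {Ω : Type*} (Φ : Ω → Config) (n : ℕ) : Ω → Config :=
  fun ω => followerStep^[n] (Φ ω)

/-- `Φ` is a Poisson point process with intensity measure `Λ`. -/
def IsPoissonProcess {Ω : Type*} [MeasurableSpace Ω] (P : Measure Ω) (Φ : Ω → Config)
    (Λ : Measure Plane) : Prop :=
  Measurable Φ ∧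
    ∀ (j : ℕ) (B : Fin j → Set Plane), (∀ i, MeasurableSet (B i)) → (∀ i, Λ (B i) ≠ ⊤) →
      Pairwise (fun i k => Disjoint (B i) (B k)) → ∀ m : Fin j → ℕ,
        P.real {ω | ∀ i, (Φ ω).toMeasure (B i) = m i} =
          ∏ i, (Λ (B i)).toReal ^ m i / (m i).factorial * Real.exp (-(Λ (B i)).toReal)

/-- The point process `Ψ` is a (translation-equivariant) factor of the point process `Φ`. -/
def IsFactor {Ω : Type*} [MeasurableSpace Ω] (P : Measure Ω) (Φ Ψ : Ω → Config) : Prop :=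
  ∃ F : Config → Config, Measurable F ∧ (∀ t φ, F (shift t φ) = shift t (F φ)) ∧
    ∀ᵐ ω ∂P, Ψ ω = F (Φ ω)

/-- A stationary framework: a probability space with a measurable flow, indexed by the plane, that
preserves the probability. -/
structure IsStationaryFramework {Ω : Type*} [MeasurableSpace Ω] (θ : Plane → Ω → Ω)
    (P : Measure Ω) : Prop where
  prob : IsProbabilityMeasure P
  flow_zero : ∀ ω, θ 0 ω = ω
  flow_add : ∀ s t ω, θ (s + t) ω = θ s (θ t ω)
  measurable : Measurable fun p : Plane × Ω => θ p.1 p.2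
  invariant : ∀ t, P.map (θ t) = P

/-- A stationary framework is mixing if `P (A₁ ∩ θ_{-x} A₂) → P A₁ * P A₂` as `|x| → ∞`. -/
def IsMixing {Ω : Type*} [MeasurableSpace Ω] (θ : Plane → Ω → Ω) (P : Measure Ω) : Prop :=
  IsStationaryFramework θ P ∧
    ∀ A₁ A₂ : Set Ω, MeasurableSet A₁ → MeasurableSet A₂ →
      Tendsto (fun x : Plane => P (A₁ ∩ θ (-x) '' A₂)) (Bornology.cobounded Plane)
        (𝓝 (P A₁ * P A₂))

/-- A point process is mixing if its law is, for the spatial shifts. -/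
def IsMixingProcess {Ω : Type*} [MeasurableSpace Ω] (P : Measure Ω) (Φ : Ω → Config) : Prop :=
  Measurable Φ ∧ IsMixing shift (P.map Φ)

end FollowerDynamics

end

/-!
One step of the dynamics, and hence its `n`-th iterate, is a measurable map on configurations that
commutes with the shifts. So `Φ_n` is a factor of `Φ`, and a factor of a stationary mixing process
is stationary and mixing. It remains to see that the step is measurable and that the Poisson
process is mixing.

*Measurability of the step.* The statement that `y` is the leader of `x` quantifies over all other
agents. Since a configuration is purely atomic, such quantifiers amount to the vanishing, or not, of
the mass of a Borel set (`IsCounting.follows_iff`, `measurable_leader`), and this mass is a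
measurable function of all parameters (`measurable_toMeasure_section`). No measurable enumeration of
the agents is needed.

*Mixing of the Poisson process.* The events determined by the numbers of agents in the cells of a
finite Borel partition of a bounded window form a π-system generating the σ-algebra of
configurations (`isPiSystem_boundedEvents`, `generateFrom_boundedEvents`), and their probabilities
are computed from products of Poisson laws. Hence the law of the process is determined by its
intensity (`IsPoissonProcess.map_eq`), so it is invariant under the shifts, and events local to
disjoint windows are independent (`IsPoissonProcess.map_inter_eq_mul`). For two local events, the
mixing limit is thus attained as soon as the shifted window has left the first one; it extends to
all events by applying the π-λ theorem to each of the two events in turn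
(`tendsto_measureReal_inter_preimage`).
-/

namespace FollowerDynamics

/-! ### Configurations -/

theorem Config.isCounting (φ : Config) : IsCounting φ.toMeasure := φ.2

theorem Config.ext {φ ψ : Config} (h : φ.toMeasure = ψ.toMeasure) : φ = ψ := Subtype.ext h

@[fun_prop]
theorem measurable_toMeasure : Measurable Config.toMeasure := measurable_subtype_coe

theorem measurable_config_mk {X : Type*} [MeasurableSpace X] {f : X → Config}
    (h : ∀ B, MeasurableSet B → Measurable fun x => (f x).toMeasure B) : Measurable f :=
  (Measure.measurable_of_measurable_coe (fun x => (f x).toMeasure) h).subtype_mk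
    (h := fun x => (f x).2)

/-- On a bounded set, a configuration takes a natural number as its value. -/
theorem Config.exists_nat_apply (φ : Config) {B : Set Plane} (hB : Bornology.IsBounded B)
    (hm : MeasurableSet B) : ∃ k : ℕ, φ.toMeasure B = k := by
  classical
  obtain ⟨μ, ι, hι, s, hs, rfl⟩ := φ
  refine ⟨(hs B hB).toFinset.card, ?_⟩
  change (Measure.sum fun i => Measure.dirac (s i)) B = _
  rw [Measure.sum_apply _ hm, tsum_eq_sum (s := (hs B hB).toFinset)]
  · rw [Finset.sum_congr rfl (g := fun _ => 1)]
    · simp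
    · intro i hi
      have : s i ∈ B := by simpa using hi
      simp [Measure.dirac_apply' _ hm, this]
  · intro i hi
    simpa [Measure.dirac_apply' _ hm] using hi

theorem Config.apply_ne_top (φ : Config) {B : Set Plane} (hB : Bornology.IsBounded B)
    (hm : MeasurableSet B) : φ.toMeasure B ≠ ⊤ := by
  obtain ⟨k, hk⟩ := φ.exists_nat_apply hB hm
  simp [hk]

/-- A counting measure is purely atomic. -/
theorem IsCounting.exists_atom {μ : Measure Plane} (h : IsCounting μ) {S : Set Plane}
    (hS : MeasurableSet S) (h0 : μ S ≠ 0) : ∃ y ∈ S, μ {y} ≠ 0 := by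
  obtain ⟨ι, hι, s, -, rfl⟩ := h
  rw [Measure.sum_apply _ hS, Ne, ENNReal.tsum_eq_zero, not_forall] at h0
  obtain ⟨i, hi⟩ := h0
  have hi' : s i ∈ S := by
    by_contra hc
    simp [Measure.dirac_apply' _ hS, hc] at hi
  refine ⟨s i, hi', fun h1 => ?_⟩
  rw [Measure.sum_apply _ (measurableSet_singleton _), ENNReal.tsum_eq_zero] at h1
  simpa using h1 i

theorem IsCounting.apply_eq_zero_iff {μ : Measure Plane} (h : IsCounting μ) {S : Set Plane}
    (hS : MeasurableSet S) : μ S = 0 ↔ ∀ y ∈ S, μ {y} = 0 := by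
  refine ⟨fun h0 y hy => measure_mono_null (Set.singleton_subset_iff.2 hy) h0, fun h0 => ?_⟩
  by_contra hc
  obtain ⟨y, hy, hy'⟩ := h.exists_atom hS hc
  exact hy' (h0 y hy)

/-- The mass that a measurable random configuration gives to a section of a jointly measurable set
depends measurably on the parameter. The measurability of the dynamics reduces to this. -/
theorem measurable_toMeasure_section {X : Type*} [MeasurableSpace X] {f : X → Config}
    (hf : Measurable f) {S : Set (X × Plane)} (hS : MeasurableSet S) :
    Measurable fun x => (f x).toMeasure (Prod.mk x ⁻¹' S) := by
  have hcover : (⋃ n : ℕ, Metric.ball (0 : Plane) n) = Set.univ := Metric.iUnion_ball_nat 0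
  have hmono : Monotone fun n : ℕ => Metric.ball (0 : Plane) n := fun m n h =>
    Metric.ball_subset_ball (by exact_mod_cast h)
  have key : ∀ x, (f x).toMeasure (Prod.mk x ⁻¹' S) =
      ⨆ n : ℕ, (f x).toMeasure.restrict (Metric.ball (0 : Plane) n) (Prod.mk x ⁻¹' S) := by
    intro x
    rw [← Measure.restrict_iUnion_apply_eq_iSup hmono.directed_le (measurable_prodMk_left hS),
      hcover, Measure.restrict_univ]
  simp_rw [key]
  refine Measurable.iSup fun n => ?_
  -- The restriction to a ball is a kernel of finite measures, although not uniformly finite.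
  let κ : ProbabilityTheory.Kernel X Plane :=
    ⟨fun x => (f x).toMeasure.restrict (Metric.ball (0 : Plane) n),
      Measure.measurable_of_measurable_coe _ fun B hB => by
        simp_rw [Measure.restrict_apply hB]
        exact (Measure.measurable_coe (hB.inter Metric.isOpen_ball.measurableSet)).comp
          (measurable_toMeasure.comp hf)⟩
  refine ProbabilityTheory.Kernel.measurable_kernel_prodMk_left_of_finite (κ := κ) hS fun x => ?_
  refine ⟨?_⟩
  change (f x).toMeasure.restrict (Metric.ball (0 : Plane) n) Set.univ < ⊤
  rw [Measure.restrict_apply_univ]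
  exact ((f x).apply_ne_top Metric.isBounded_ball Metric.isOpen_ball.measurableSet).lt_top

@[fun_prop]
theorem measurable_toMeasure_singleton {X : Type*} [MeasurableSpace X] {f : X → Config}
    {g : X → Plane} (hf : Measurable f) (hg : Measurable g) :
    Measurable fun x => (f x).toMeasure {g x} := by
  have hS : MeasurableSet {p : X × Plane | p.2 = g p.1} :=
    measurableSet_eq_fun measurable_snd (hg.comp measurable_fst)
  exact measurable_toMeasure_section hf hS

/-! ### Leaders -/

theorem measurableSet_precedesFrom {X : Type*} [MeasurableSpace X] {f g h : X → Plane}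
    (hf : Measurable f) (hg : Measurable g) (hh : Measurable h) :
    MeasurableSet {x | PrecedesFrom (f x) (g x) (h x)} := by
  have h0 : ∀ i : Fin 2, Measurable fun x => g x i := fun i => by fun_prop
  have h1 : ∀ i : Fin 2, Measurable fun x => h x i := fun i => by fun_prop
  have hd := hf.dist hg
  have hd' := hf.dist hh
  exact (measurableSet_lt hd hd').union ((measurableSet_eq_fun hd hd').inter
    ((measurableSet_lt (h0 0) (h1 0)).union
      ((measurableSet_eq_fun (h0 0) (h1 0)).inter (measurableSet_le (h0 1) (h1 1)))))

theorem PrecedesFrom.antisymm {x y z : Plane} (h : PrecedesFrom x y z) (h' : PrecedesFrom x z y) :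
    y = z := by
  have : y 0 = z 0 ∧ y 1 = z 1 := by
    rcases h with h | ⟨h1, h | ⟨h2, h⟩⟩ <;> rcases h' with h' | ⟨h1', h' | ⟨h2', h'⟩⟩ <;>
      first | exact ⟨h2, le_antisymm h h'⟩ | linarith
  ext i
  fin_cases i
  exacts [this.1, this.2]

theorem Follows.unique {μ : Measure Plane} {x y z : Plane} (h : Follows μ x y)
    (h' : Follows μ x z) : y = z :=
  (h.2 z h'.1).antisymm (h'.2 y h.1)

theorem Follows.leader_eq {μ : Measure Plane} {x y : Plane} (h : Follows μ x y) :
    leader μ x = y := by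
  have hex : ∃ y, Follows μ x y := ⟨y, h⟩
  rw [leader, dif_pos hex]
  exact hex.choose_spec.unique h

theorem leader_eq_self {μ : Measure Plane} {x : Plane} (h : ¬∃ y, Follows μ x y) :
    leader μ x = x := by
  rw [leader, dif_neg h]

/-- The universal quantifier over the other agents is the vanishing of the mass of a Borel set. -/
theorem IsCounting.follows_iff {μ : Measure Plane} (h : IsCounting μ) (x y : Plane) :
    Follows μ x y ↔ (μ {y} ≠ 0 ∧ (y = x → 2 ≤ μ {x})) ∧
      μ {z | z ≠ x ∧ ¬PrecedesFrom x y z} = 0 ∧ (2 ≤ μ {x} → PrecedesFrom x y x) := by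
  have hm : MeasurableSet {z | z ≠ x ∧ ¬PrecedesFrom x y z} :=
    (measurableSet_eq.compl : MeasurableSet {z | z ≠ x}).inter
      (measurableSet_precedesFrom measurable_const measurable_const measurable_id).compl
  rw [h.apply_eq_zero_iff hm]
  refine and_congr Iff.rfl ⟨fun hz => ⟨fun z hzx => ?_, fun h2 => hz x ⟨?_, fun _ => h2⟩⟩, ?_⟩
  · by_contra h0
    exact hzx.2 (hz z ⟨h0, fun e => (hzx.1 e).elim⟩)
  · intro h0
    simp [h0] at h2
  · rintro ⟨h1, h2⟩ z ⟨hz0, hz⟩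
    by_cases hzx : z = x
    · exact hzx ▸ h2 (hz hzx)
    · by_contra hc
      exact hz0 (h1 z ⟨hzx, hc⟩)

theorem measurableSet_follows {X : Type*} [MeasurableSpace X] {f : X → Config} {g h : X → Plane}
    (hf : Measurable f) (hg : Measurable g) (hh : Measurable h) :
    MeasurableSet {x | Follows (f x).toMeasure (g x) (h x)} := by
  have hsec : MeasurableSet
      {p : X × Plane | p.2 ≠ g p.1 ∧ ¬PrecedesFrom (g p.1) (h p.1) p.2} :=
    (measurableSet_eq_fun measurable_snd (hg.comp measurable_fst)).compl.inter
      (measurableSet_precedesFrom (hg.comp measurable_fst) (hh.comp measurable_fst)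
        measurable_snd).compl
  have h2 : MeasurableSet {x | 2 ≤ (f x).toMeasure {g x}} :=
    measurableSet_le measurable_const (measurable_toMeasure_singleton hf hg)
  have h3 : MeasurableSet {x | (f x).toMeasure {h x} = 0} :=
    measurableSet_eq_fun (measurable_toMeasure_singleton hf hh) measurable_const
  have h4 := measurableSet_eq_fun (measurable_toMeasure_section hf hsec)
    (measurable_const (a := (0 : ENNReal)))
  simp_rw [fun x => (f x).isCounting.follows_iff (g x) (h x)]
  exact (h3.compl.inter ((measurableSet_eq_fun hh hg).imp h2)).inter
    (h4.inter (h2.imp (measurableSet_precedesFrom hg hh hg)))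

/-- Uniqueness of the leader turns the existential quantifier over leaders in a Borel set into the
positivity of the mass of a Borel set. -/
theorem measurable_leader {X : Type*} [MeasurableSpace X] {f : X → Config} {g : X → Plane}
    (hf : Measurable f) (hg : Measurable g) :
    Measurable fun x => leader (f x).toMeasure (g x) := by
  have hF : MeasurableSet {p : X × Plane | Follows (f p.1).toMeasure (g p.1) p.2} :=
    measurableSet_follows (hf.comp measurable_fst) (hg.comp measurable_fst) measurable_snd
  have hex : ∀ B : Set Plane, MeasurableSet B →
      MeasurableSet {x | ∃ y ∈ B, Follows (f x).toMeasure (g x) y} := by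
    intro B hB
    have hS := hF.inter (measurable_snd (α := X) hB)
    have := (measurableSet_eq_fun (measurable_toMeasure_section hf hS)
      (measurable_const (a := (0 : ENNReal)))).compl
    convert! this using 1
    ext x
    simp only [Set.mem_ofPred_eq, Set.mem_compl_iff]
    rw [(f x).isCounting.apply_eq_zero_iff (measurable_prodMk_left hS), not_forall]
    constructor
    · rintro ⟨y, hy, hxy⟩
      exact ⟨y, fun hc => hxy.1.1 (hc ⟨hxy, hy⟩)⟩
    · rintro ⟨y, hy⟩
      rw [Classical.not_imp] at hy
      exact ⟨y, hy.1.2, hy.1.1⟩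
  intro B hB
  have : (fun x => leader (f x).toMeasure (g x)) ⁻¹' B =
      {x | ∃ y ∈ B, Follows (f x).toMeasure (g x) y} ∪
        ({x | ∃ y ∈ Set.univ, Follows (f x).toMeasure (g x) y}ᶜ ∩ g ⁻¹' B) := by
    ext x
    simp only [Set.mem_preimage, Set.mem_union, Set.mem_ofPred_eq, Set.mem_inter_iff,
      Set.mem_compl_iff, Set.mem_univ, true_and]
    by_cases h : ∃ y, Follows (f x).toMeasure (g x) y
    · obtain ⟨y, hy⟩ := h
      rw [hy.leader_eq]
      constructor
      · exact fun h => Or.inl ⟨y, h, hy⟩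
      · rintro (⟨z, hz, hxz⟩ | h)
        · exact hxz.unique hy ▸ hz
        · exact (h.1 ⟨y, hy⟩).elim
    · rw [leader_eq_self h]
      constructor
      · exact fun hx => Or.inr ⟨h, hx⟩
      · rintro (⟨z, hz, hxz⟩ | h')
        · exact (h ⟨z, hxz⟩).elim
        · exact h'.2
  rw [this]
  exact (hex B hB).union ((hex _ MeasurableSet.univ).compl.inter (hg hB))

theorem measurable_move {X : Type*} [MeasurableSpace X] {f : X → Config} {g : X → Plane}
    (hf : Measurable f) (hg : Measurable g) :
    Measurable fun x => move (f x).toMeasure (g x) := by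
  have := measurable_leader hf hg
  simp only [move, midpoint_eq_smul_add]
  fun_prop

/-! ### The dynamics as a measurable equivariant map -/

theorem followerStep_apply (φ : Config) {B : Set Plane} (hB : MeasurableSet B) :
    (followerStep φ).toMeasure B = φ.toMeasure (move φ.toMeasure ⁻¹' B) :=
  Measure.map_apply (measurable_move (f := fun _ : Plane => φ) measurable_const measurable_id) hB

theorem shift_apply (t : Plane) (φ : Config) {B : Set Plane} (hB : MeasurableSet B) :
    (shift t φ).toMeasure B = φ.toMeasure ((fun x => x - t) ⁻¹' B) :=
  Measure.map_apply (by fun_prop) hB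

theorem measurable_followerStep : Measurable followerStep := by
  refine measurable_config_mk fun B hB => ?_
  simp_rw [fun φ => followerStep_apply φ hB]
  exact measurable_toMeasure_section measurable_id
    (measurable_move (X := Config × Plane) measurable_fst measurable_snd hB)

theorem measurable_shift_uncurry : Measurable fun p : Plane × Config => shift p.1 p.2 := by
  refine measurable_config_mk fun B hB => ?_
  simp_rw [fun p : Plane × Config => shift_apply p.1 p.2 hB]
  have hm : Measurable fun q : (Plane × Config) × Plane => q.2 - q.1.1 := by fun_prop
  exact measurable_toMeasure_section measurable_snd (hm hB)

theorem measurable_shift (t : Plane) : Measurable (shift t) :=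
  measurable_shift_uncurry.comp measurable_prodMk_left

theorem shift_zero (φ : Config) : shift 0 φ = φ := by
  refine Config.ext (Measure.ext fun B hB => ?_)
  rw [shift_apply _ _ hB]
  simp

theorem shift_add (s t : Plane) (φ : Config) : shift (s + t) φ = shift s (shift t φ) := by
  refine Config.ext (Measure.ext fun B hB => ?_)
  rw [shift_apply _ _ hB, shift_apply _ _ hB, shift_apply _ _ (by measurability)]
  congr 1
  ext x
  simp [sub_sub, add_comm]

theorem shift_neg_image (t : Plane) (A : Set Config) : shift (-t) '' A = shift t ⁻¹' A :=
  congrFun (Set.image_eq_preimage_of_inverse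
    (fun φ => by rw [← shift_add, add_neg_cancel, shift_zero])
    fun φ => by rw [← shift_add, neg_add_cancel, shift_zero]) A

theorem shift_singleton (t : Plane) (φ : Config) (x : Plane) :
    (shift t φ).toMeasure {x - t} = φ.toMeasure {x} := by
  rw [shift_apply _ _ (measurableSet_singleton _)]
  congr 1
  ext y
  simp

theorem precedesFrom_sub (t x y z : Plane) :
    PrecedesFrom (x - t) (y - t) (z - t) ↔ PrecedesFrom x y z := by
  simp [PrecedesFrom]

theorem follows_shift (t : Plane) (φ : Config) (x y : Plane) :
    Follows (shift t φ).toMeasure (x - t) (y - t) ↔ Follows φ.toMeasure x y := by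
  have ho : ∀ z, z - t ∈ others (shift t φ).toMeasure (x - t) ↔ z ∈ others φ.toMeasure x := by
    intro z
    simp [others, shift_singleton]
  refine and_congr (ho y) ⟨fun h z hz => ?_, fun h z hz => ?_⟩
  · exact (precedesFrom_sub t x y z).1 (h _ ((ho z).2 hz))
  · have := (precedesFrom_sub t x y (z + t)).2 (h _ ((ho (z + t)).1 (by simpa using hz)))
    simpa using this

theorem leader_shift (t : Plane) (φ : Config) (x : Plane) :
    leader (shift t φ).toMeasure (x - t) = leader φ.toMeasure x - t := by
  by_cases h : ∃ y, Follows φ.toMeasure x y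
  · obtain ⟨y, hy⟩ := h
    rw [hy.leader_eq, ((follows_shift t φ x y).2 hy).leader_eq]
  · rw [leader_eq_self h, leader_eq_self]
    rintro ⟨y, hy⟩
    refine h ⟨y + t, (follows_shift t φ x (y + t)).1 (by simpa using hy)⟩

theorem move_shift (t : Plane) (φ : Config) (x : Plane) :
    move (shift t φ).toMeasure (x - t) = move φ.toMeasure x - t := by
  simp only [move, leader_shift, midpoint_eq_smul_add, invOf_eq_inv]
  module

theorem followerStep_shift (t : Plane) (φ : Config) :
    followerStep (shift t φ) = shift t (followerStep φ) := by
  refine Config.ext (Measure.ext fun B hB => ?_)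
  have hmv : Measurable (move (shift t φ).toMeasure) :=
    measurable_move (f := fun _ : Plane => shift t φ) measurable_const measurable_id
  have hsub : Measurable fun x : Plane => x - t := by fun_prop
  rw [followerStep_apply _ hB, shift_apply _ _ (hmv hB), shift_apply _ _ hB,
    followerStep_apply _ (hsub hB)]
  congr 1
  ext x
  simp [move_shift]

theorem measurable_followerStep_iterate (n : ℕ) : Measurable followerStep^[n] :=
  measurable_followerStep.iterate n

theorem followerStep_iterate_shift (n : ℕ) (t : Plane) (φ : Config) :
    followerStep^[n] (shift t φ) = shift t (followerStep^[n] φ) :=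
  Function.Commute.iterate_left (followerStep_shift t) n φ

/-! ### Local events -/

/-- The number of agents in `B`. It is the junk value `0` if there are infinitely many. -/
noncomputable def count (B : Set Plane) (φ : Config) : ℕ := ⌊(φ.toMeasure B).toReal⌋₊

theorem coe_count {B : Set Plane} (hB : Bornology.IsBounded B) (hm : MeasurableSet B)
    (φ : Config) : (count B φ : ENNReal) = φ.toMeasure B := by
  obtain ⟨k, hk⟩ := φ.exists_nat_apply hB hm
  simp [count, hk]

@[fun_prop]
theorem measurable_count {B : Set Plane} (hm : MeasurableSet B) : Measurable (count B) :=
  Nat.measurable_floor.comp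
    (((Measure.measurable_coe hm).comp measurable_toMeasure).ennreal_toReal)

theorem count_eq_iff {B : Set Plane} (hB : Bornology.IsBounded B) (hm : MeasurableSet B)
    (φ : Config) (k : ℕ) : count B φ = k ↔ φ.toMeasure B = k := by
  rw [← coe_count hB hm, Nat.cast_inj]

theorem count_shift {B : Set Plane} (hm : MeasurableSet B) (t : Plane) (φ : Config) :
    count B (shift t φ) = count ((fun x => x - t) ⁻¹' B) φ := by
  rw [count, count, shift_apply _ _ hm]

theorem count_eq_sum_fiber {ι : Type*} [Fintype ι] {B : Set Plane} (hB : Bornology.IsBounded B)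
    (hm : MeasurableSet B) {g : Plane → ι} (hg : ∀ i, MeasurableSet (g ⁻¹' {i})) (φ : Config) :
    count B φ = ∑ i, count (B ∩ g ⁻¹' {i}) φ := by
  rw [← Nat.cast_inj (R := ENNReal), Nat.cast_sum, coe_count hB hm]
  simp_rw [fun i => coe_count (hB.subset (Set.inter_subset_left (t := g ⁻¹' {i})))
    (hm.inter (hg i)) φ]
  have := sum_measure_preimage_singleton (μ := φ.toMeasure.restrict B) Finset.univ
    (fun i _ => hg i)
  simp only [Finset.coe_univ, Set.preimage_univ, Measure.restrict_apply_univ] at this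
  rw [← this]
  refine Finset.sum_congr rfl fun i _ => ?_
  rw [Measure.restrict_apply (hg i), Set.inter_comm]

/-- The numbers of agents in the cells of the partition of `K` into the fibers of `g`. -/
noncomputable def cellCount {ι : Type*} (K : Set Plane) (g : Plane → ι) (φ : Config) : ι → ℕ :=
  fun i => count (K ∩ g ⁻¹' {i}) φ

/-- The events that depend only on the numbers of agents in the cells of some finite Borel
partition of `K`. A partition is encoded as the fibers of a map to a finite type, so that the
common refinement of two partitions is the product map. -/
def localEvents (K : Set Plane) : Set (Set Config) :=
  {A | ∃ (ι : Type) (_ : Fintype ι) (g : Plane → ι) (S : Set (ι → ℕ)),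
    (∀ i, MeasurableSet (g ⁻¹' {i})) ∧ A = cellCount K g ⁻¹' S}

theorem measurable_cellCount {ι : Type*} {K : Set Plane} (hK : MeasurableSet K)
    {g : Plane → ι} (hg : ∀ i, MeasurableSet (g ⁻¹' {i})) : Measurable (cellCount K g) :=
  measurable_pi_lambda _ fun i => measurable_count (hK.inter (hg i))

theorem measurableSet_of_mem_localEvents {K : Set Plane} (hK : MeasurableSet K) {A : Set Config}
    (hA : A ∈ localEvents K) : MeasurableSet A := by
  obtain ⟨ι, _, g, S, hg, rfl⟩ := hA
  exact measurable_cellCount hK hg (MeasurableSet.of_discrete (s := S))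

theorem localEvents_mono {K K' : Set Plane} (hK : MeasurableSet K) (h : K ⊆ K') :
    localEvents K ⊆ localEvents K' := by
  rintro A ⟨ι, _, g, S, hg, rfl⟩
  have hfib : ∀ (i : ι) (p : Prop), (fun x => (g x, x ∈ K)) ⁻¹' {(i, p)} =
      g ⁻¹' {i} ∩ {x | (x ∈ K) = p} := fun i p => by
    ext x
    simp
  -- Separate the cells inside `K` from those outside; `S` constrains the former only.
  refine ⟨ι × Prop, inferInstance, fun x => (g x, x ∈ K), {f | (fun i => f (i, True)) ∈ S},
    ?_, ?_⟩
  · rintro ⟨i, p⟩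
    rw [hfib]
    exact (hg i).inter (hK.mem (measurableSet_singleton p))
  · ext φ
    have : cellCount K g φ = fun i => cellCount K' (fun x => (g x, x ∈ K)) φ (i, True) := by
      funext i
      simp only [cellCount, hfib]
      congr 1
      ext x
      simp only [Set.mem_inter_iff, Set.mem_preimage, Set.mem_singleton_iff, Set.mem_ofPred_eq,
        eq_iff_iff, iff_true]
      exact ⟨fun hx => ⟨h hx.1, hx.2, hx.1⟩, fun hx => ⟨hx.2.2, hx.2.1⟩⟩
    simp [this]

theorem inter_mem_localEvents {K : Set Plane} (hK : Bornology.IsBounded K)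
    (hm : MeasurableSet K) {A A' : Set Config} (hA : A ∈ localEvents K)
    (hA' : A' ∈ localEvents K) : A ∩ A' ∈ localEvents K := by
  obtain ⟨ι, _, g, S, hg, rfl⟩ := hA
  obtain ⟨κ, _, g', S', hg', rfl⟩ := hA'
  have hfib : ∀ i k, (fun x => (g x, g' x)) ⁻¹' {(i, k)} = g ⁻¹' {i} ∩ g' ⁻¹' {k} :=
    fun i k => by
      ext x
      simp
  refine ⟨ι × κ, inferInstance, fun x => (g x, g' x),
    {f | (fun i => ∑ k, f (i, k)) ∈ S ∧ (fun k => ∑ i, f (i, k)) ∈ S'}, ?_, ?_⟩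
  · rintro ⟨i, k⟩
    rw [hfib]
    exact (hg i).inter (hg' k)
  · ext φ
    have h1 : cellCount K g φ = fun i => ∑ k, cellCount K (fun x => (g x, g' x)) φ (i, k) := by
      funext i
      simp only [cellCount, hfib]
      rw [count_eq_sum_fiber (hK.subset Set.inter_subset_left) (hm.inter (hg i)) hg']
      simp only [Set.inter_assoc]
    have h2 : cellCount K g' φ = fun k => ∑ i, cellCount K (fun x => (g x, g' x)) φ (i, k) := by
      funext k
      simp only [cellCount, hfib]
      rw [count_eq_sum_fiber (hK.subset Set.inter_subset_left) (hm.inter (hg' k)) hg]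
      simp only [Set.inter_assoc, Set.inter_comm (g' ⁻¹' {k})]
    simp [h1, h2]

theorem preimage_shift_mem_localEvents {K : Set Plane} (hm : MeasurableSet K) {A : Set Config}
    (hA : A ∈ localEvents K) (t : Plane) :
    shift t ⁻¹' A ∈ localEvents ((fun x => x - t) ⁻¹' K) := by
  obtain ⟨ι, _, g, S, hg, rfl⟩ := hA
  have hsub : Measurable fun x : Plane => x - t := by fun_prop
  refine ⟨ι, inferInstance, fun x => g (x - t), S, fun i => hsub (hg i), ?_⟩
  ext φ
  have : cellCount K g (shift t φ) =
      cellCount ((fun x => x - t) ⁻¹' K) (fun x => g (x - t)) φ := by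
    funext i
    rw [cellCount, count_shift (hm.inter (hg i))]
    rfl
  simp [this]

/-- The local events of all bounded windows. -/
def boundedEvents : Set (Set Config) := ⋃ r : ℕ, localEvents (Metric.ball 0 r)

theorem isPiSystem_boundedEvents : IsPiSystem boundedEvents := by
  intro A hA A' hA' _
  obtain ⟨r, hr⟩ := Set.mem_iUnion.1 hA
  obtain ⟨r', hr'⟩ := Set.mem_iUnion.1 hA'
  refine Set.mem_iUnion.2 ⟨max r r', inter_mem_localEvents Metric.isBounded_ball
    Metric.isOpen_ball.measurableSet (localEvents_mono Metric.isOpen_ball.measurableSet ?_ hr)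
    (localEvents_mono Metric.isOpen_ball.measurableSet ?_ hr')⟩
  · exact Metric.ball_subset_ball (by exact_mod_cast le_max_left _ _)
  · exact Metric.ball_subset_ball (by exact_mod_cast le_max_right _ _)

theorem generateFrom_boundedEvents :
    (inferInstance : MeasurableSpace Config) = MeasurableSpace.generateFrom boundedEvents := by
  refine le_antisymm ?_ (MeasurableSpace.generateFrom_le fun A hA => ?_)
  · have hcount : ∀ (r : ℕ) (B : Set Plane), MeasurableSet B →
        Measurable[MeasurableSpace.generateFrom boundedEvents]
          (count (Metric.ball 0 r ∩ B)) := by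
      intro r B hB
      refine @measurable_to_countable' _ _ _ _ (MeasurableSpace.generateFrom boundedEvents) _
        fun k => MeasurableSpace.measurableSet_generateFrom (Set.mem_iUnion.2 ⟨r, ?_⟩)
      -- The partition of the ball into `B` and its complement is indexed by `Prop`.
      refine ⟨Prop, inferInstance, fun x => x ∈ B, {f | f True = k},
        fun p => hB.mem (measurableSet_singleton p), ?_⟩
      ext φ
      simp [cellCount, Set.preimage]
    have hid : @Measurable Config Config (MeasurableSpace.generateFrom boundedEvents) _ id := by
      refine @measurable_config_mk _ (MeasurableSpace.generateFrom boundedEvents) _ fun B hB => ?_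
      have hmono : Monotone fun n : ℕ => Metric.ball (0 : Plane) n ∩ B := fun m n h =>
        Set.inter_subset_inter_left _ (Metric.ball_subset_ball (by exact_mod_cast h))
      have key : ∀ φ : Config, φ.toMeasure B =
          ⨆ r : ℕ, (count (Metric.ball 0 r ∩ B) φ : ENNReal) := by
        intro φ
        simp_rw [fun r : ℕ => coe_count (Metric.isBounded_ball.subset
          (Set.inter_subset_left (s := Metric.ball (0 : Plane) r) (t := B)))
          (Metric.isOpen_ball.measurableSet.inter hB) φ]
        rw [← hmono.measure_iUnion, ← Set.iUnion_inter, Metric.iUnion_ball_nat, Set.univ_inter]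
      simp_rw [id, key]
      exact Measurable.iSup fun r => measurable_from_top.comp (hcount r B hB)
    intro A hA
    exact hid hA
  · obtain ⟨r, hr⟩ := Set.mem_iUnion.1 hA
    exact measurableSet_of_mem_localEvents Metric.isOpen_ball.measurableSet hr

/-! ### The Poisson process -/

section Poisson

variable {Ω : Type*} [MeasurableSpace Ω] {P : Measure Ω} {Φ Ψ : Ω → Config}
  {Λ : Measure Plane}

theorem IsPoissonProcess.map_count [IsProbabilityMeasure P] (h : IsPoissonProcess P Φ Λ)
    {ι : Type*} [Fintype ι] {B : ι → Set Plane} (hm : ∀ i, MeasurableSet (B i))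
    (hb : ∀ i, Bornology.IsBounded (B i))
    (hΛ : ∀ i, Λ (B i) ≠ ⊤) (hd : Pairwise fun i k => Disjoint (B i) (B k)) :
    P.map (fun ω i => count (B i) (Φ ω)) =
      Measure.pi fun i => ProbabilityTheory.poissonMeasure (Λ (B i)).toNNReal := by
  have hmeas : Measurable fun ω i => count (B i) (Φ ω) :=
    measurable_pi_lambda _ fun i => (measurable_count (hm i)).comp h.1
  have : IsProbabilityMeasure (P.map fun ω i => count (B i) (Φ ω)) :=
    Measure.isProbabilityMeasure_map hmeas.aemeasurable
  refine Measure.ext_of_singleton fun m => ?_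
  rw [← ENNReal.toReal_eq_toReal_iff' (measure_ne_top _ _) (measure_ne_top _ _),
    Measure.map_apply hmeas (measurableSet_singleton _), Measure.pi_singleton,
    ENNReal.toReal_prod]
  let e := Fintype.equivFin ι
  have := h.2 (Fintype.card ι) (fun i => B (e.symm i)) (fun i => hm _) (fun i => hΛ _)
    (fun i k hik => hd (e.symm.injective.ne hik)) (fun i => m (e.symm i))
  rw [measureReal_def, Equiv.prod_comp e.symm (fun i => (Λ (B i)).toReal ^ m i /
    (m i).factorial * Real.exp (-(Λ (B i)).toReal))] at this
  convert! this using 2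
  · congr 1
    ext ω
    simp only [Set.mem_preimage, Set.mem_singleton_iff, Set.mem_ofPred_eq, funext_iff,
      count_eq_iff (hb _) (hm _)]
    exact ⟨fun H i => H _, fun H i => by simpa using H (e i)⟩
  · rename_i i _
    rw [← measureReal_def, ProbabilityTheory.poissonMeasure_real_singleton,
      ENNReal.coe_toNNReal_eq_toReal]
    ring

theorem IsPoissonProcess.map_cellCount [IsProbabilityMeasure P] [IsFiniteMeasureOnCompacts Λ]
    (h : IsPoissonProcess P Φ Λ) {ι : Type*} [Fintype ι] {K : Set Plane}
    (hK : Bornology.IsBounded K) (hm : MeasurableSet K) {g : Plane → ι}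
    (hg : ∀ i, MeasurableSet (g ⁻¹' {i})) :
    P.map (fun ω => cellCount K g (Φ ω)) =
      Measure.pi fun i => ProbabilityTheory.poissonMeasure (Λ (K ∩ g ⁻¹' {i})).toNNReal := by
  have hb : ∀ i, Bornology.IsBounded (K ∩ g ⁻¹' {i}) := fun i => hK.subset Set.inter_subset_left
  refine h.map_count (fun i => hm.inter (hg i)) hb (fun i => (hb i).measure_lt_top.ne) ?_
  intro i k hik
  exact (Set.disjoint_left.2 fun x hx hx' => hik (hx.symm.trans hx')).mono
    Set.inter_subset_right Set.inter_subset_right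

/-- The law of a Poisson process is determined by its intensity measure. -/
theorem IsPoissonProcess.map_eq [IsProbabilityMeasure P] [IsFiniteMeasureOnCompacts Λ]
    (h : IsPoissonProcess P Φ Λ) (h' : IsPoissonProcess P Ψ Λ) : P.map Φ = P.map Ψ := by
  have := Measure.isProbabilityMeasure_map (μ := P) h.1.aemeasurable
  have := Measure.isProbabilityMeasure_map (μ := P) h'.1.aemeasurable
  refine ext_of_generate_finite _ generateFrom_boundedEvents isPiSystem_boundedEvents
    (fun A hA => ?_) (by simp)
  obtain ⟨r, ι, _, g, S, hg, rfl⟩ := Set.mem_iUnion.1 hA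
  have hK : MeasurableSet (Metric.ball (0 : Plane) r) := Metric.isOpen_ball.measurableSet
  have hc := measurable_cellCount hK hg
  have hS : MeasurableSet S := .of_discrete
  rw [← Measure.map_apply hc hS, ← Measure.map_apply hc hS, Measure.map_map hc h.1,
    Measure.map_map hc h'.1]
  exact congrArg (· S) ((h.map_cellCount Metric.isBounded_ball hK hg).trans
    (h'.map_cellCount Metric.isBounded_ball hK hg).symm)

theorem IsPoissonProcess.shift (h : IsPoissonProcess P Φ Λ) (t : Plane)
    (hΛ : ∀ B, MeasurableSet B → Λ ((fun x => x - t) ⁻¹' B) = Λ B) :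
    IsPoissonProcess P (fun ω => shift t (Φ ω)) Λ := by
  refine ⟨(measurable_shift t).comp h.1, fun j B hm hf hd m => ?_⟩
  have hsub : Measurable fun x : Plane => x - t := by fun_prop
  have := h.2 j (fun i => (fun x => x - t) ⁻¹' B i) (fun i => hsub (hm i))
    (fun i => by rw [hΛ _ (hm i)]; exact hf i) (fun i k hik => (hd hik).preimage _) m
  simp_rw [fun i => hΛ _ (hm i)] at this
  simp_rw [fun ω i => shift_apply t (Φ ω) (hm i)]
  exact this

/-- Complete independence of a Poisson process. -/
theorem IsPoissonProcess.map_inter_eq_mul [IsProbabilityMeasure P] [IsFiniteMeasureOnCompacts Λ]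
    (h : IsPoissonProcess P Φ Λ) {K K' : Set Plane} (hK : Bornology.IsBounded K)
    (hK' : Bornology.IsBounded K') (hm : MeasurableSet K) (hm' : MeasurableSet K')
    (hd : Disjoint K K') {A A' : Set Config} (hA : A ∈ localEvents K)
    (hA' : A' ∈ localEvents K') :
    P.map Φ (A ∩ A') = P.map Φ A * P.map Φ A' := by
  have hAm := measurableSet_of_mem_localEvents hm hA
  have hAm' := measurableSet_of_mem_localEvents hm' hA'
  obtain ⟨ι, _, g, S, hg, rfl⟩ := hA
  obtain ⟨κ, _, g', S', hg', rfl⟩ := hA'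
  have hbd : ∀ {ν : Type} {L : Set Plane} (_ : Bornology.IsBounded L) (f : Plane → ν) (i : ν),
      Bornology.IsBounded (L ∩ f ⁻¹' {i}) := fun hL _ _ => hL.subset Set.inter_subset_left
  have hdj : ∀ {ν : Type} (L : Set Plane) (f : Plane → ν) {i k : ν}, i ≠ k →
      Disjoint (L ∩ f ⁻¹' {i}) (L ∩ f ⁻¹' {k}) := fun L f i k hik =>
    (Set.disjoint_left.2 fun x hx hx' => hik (hx.symm.trans hx')).mono
      Set.inter_subset_right Set.inter_subset_right
  -- The cells of both partitions form one disjoint family, indexed by `ι ⊕ κ`.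
  let B : ι ⊕ κ → Set Plane := Sum.elim (fun i => K ∩ g ⁻¹' {i}) fun k => K' ∩ g' ⁻¹' {k}
  have hBm : ∀ i, MeasurableSet (B i) := by
    rintro (i | k)
    exacts [hm.inter (hg i), hm'.inter (hg' k)]
  have hBb : ∀ i, Bornology.IsBounded (B i) := by
    rintro (i | k)
    exacts [hbd hK g i, hbd hK' g' k]
  have hBd : Pairwise fun i k => Disjoint (B i) (B k) := by
    rintro (i | i) (k | k) hik
    · exact hdj K g fun e => hik (e ▸ rfl)
    · exact hd.mono Set.inter_subset_left Set.inter_subset_left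
    · exact hd.symm.mono Set.inter_subset_left Set.inter_subset_left
    · exact hdj K' g' fun e => hik (e ▸ rfl)
  have hlaw := h.map_count hBm hBb (fun i => (hBb i).measure_lt_top.ne) hBd
  have hmeas : Measurable fun ω i => count (B i) (Φ ω) :=
    measurable_pi_lambda _ fun i => (measurable_count (hBm i)).comp h.1
  have hS : MeasurableSet S := .of_discrete
  have hS' : MeasurableSet S' := .of_discrete
  have hmp := measurePreserving_sumPiEquivProdPi (X := fun _ : ι ⊕ κ => ℕ)
    fun i => ProbabilityTheory.poissonMeasure (Λ (B i)).toNNReal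
  have e1 : P.map Φ (cellCount K g ⁻¹' S) = (Measure.pi fun i =>
      ProbabilityTheory.poissonMeasure (Λ (K ∩ g ⁻¹' {i})).toNNReal) S := by
    rw [← h.map_cellCount hK hm hg, Measure.map_apply h.1 hAm,
      Measure.map_apply (f := fun ω => cellCount K g (Φ ω))
        ((measurable_cellCount hm hg).comp h.1) hS]
    rfl
  have e2 : P.map Φ (cellCount K' g' ⁻¹' S') = (Measure.pi fun k =>
      ProbabilityTheory.poissonMeasure (Λ (K' ∩ g' ⁻¹' {k})).toNNReal) S' := by
    rw [← h.map_cellCount hK' hm' hg', Measure.map_apply h.1 hAm',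
      Measure.map_apply (f := fun ω => cellCount K' g' (Φ ω))
        ((measurable_cellCount hm' hg').comp h.1) hS']
    rfl
  rw [e1, e2, ← Measure.prod_prod]
  refine Eq.trans ?_ (hmp.measure_preimage (hS.prod hS').nullMeasurableSet)
  rw [← hlaw, Measure.map_apply hmeas (hmp.measurable (hS.prod hS')),
    Measure.map_apply h.1 (hAm.inter hAm')]
  rfl

end Poisson

/-! ### Mixing -/

/-- If measures `μ t`, dominated by a finite measure `ν`, converge to `c • ν` on a generating
π-system and on the whole space, they converge to it on every measurable set. -/
theorem tendsto_measureReal_of_isPiSystem {X T : Type*} [MeasurableSpace X] {ν : Measure X}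
    [IsFiniteMeasure ν] {μ : T → Measure X} (hle : ∀ t, μ t ≤ ν) {l : Filter T} {c : ℝ}
    {C : Set (Set X)} (hgen : (inferInstance : MeasurableSpace X) = MeasurableSpace.generateFrom C)
    (hC : IsPiSystem C)
    (huniv : Tendsto (fun t => (μ t).real Set.univ) l (𝓝 (c * ν.real Set.univ)))
    (h : ∀ A ∈ C, Tendsto (fun t => (μ t).real A) l (𝓝 (c * ν.real A)))
    {A : Set X} (hA : MeasurableSet A) :
    Tendsto (fun t => (μ t).real A) l (𝓝 (c * ν.real A)) := by
  have hfin : ∀ t, IsFiniteMeasure (μ t) := fun t => isFiniteMeasure_of_le ν (hle t)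
  induction A, hA using MeasurableSpace.induction_on_inter hgen hC with
  | empty => simp [tendsto_const_nhds]
  | basic A hA => exact h A hA
  | compl A hA ih =>
    simp_rw [fun t => measureReal_compl (μ := μ t) hA, measureReal_compl hA, mul_sub]
    exact huniv.sub ih
  | iUnion f hd hf ih =>
    have hsum : ∀ (ρ : Measure X) [IsFiniteMeasure ρ],
        HasSum (fun i => ρ.real (f i)) (ρ.real (⋃ i, f i)) := by
      intro ρ _
      have hne : ∑' i, ρ (f i) ≠ ⊤ := by
        rw [← measure_iUnion hd hf]
        exact measure_ne_top _ _
      have := ENNReal.hasSum_toReal hne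
      rwa [← ENNReal.tsum_toReal_eq fun i => measure_ne_top _ _, ← measure_iUnion hd hf] at this
    simp_rw [fun t => (hsum (μ t)).tsum_eq.symm, ← ((hsum ν).mul_left c).tsum_eq]
    refine tendsto_tsum_of_dominated_convergence (hsum ν).summable ih
      (Eventually.of_forall fun t i => ?_)
    rw [Real.norm_of_nonneg measureReal_nonneg]
    exact ENNReal.toReal_mono (measure_ne_top _ _) (hle t _)

/-- Mixing need only be checked on a generating π-system. -/
theorem tendsto_measureReal_inter_preimage {X T : Type*} [MeasurableSpace X] {ν : Measure X}
    [IsProbabilityMeasure ν] {θ : T → X → X} (hθ : ∀ t, MeasurePreserving (θ t) ν ν)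
    {l : Filter T} {C : Set (Set X)}
    (hgen : (inferInstance : MeasurableSpace X) = MeasurableSpace.generateFrom C)
    (hC : IsPiSystem C)
    (h : ∀ A ∈ C, ∀ B ∈ C,
      Tendsto (fun t => ν.real (A ∩ θ t ⁻¹' B)) l (𝓝 (ν.real A * ν.real B)))
    {A B : Set X} (hA : MeasurableSet A) (hB : MeasurableSet B) :
    Tendsto (fun t => ν.real (A ∩ θ t ⁻¹' B)) l (𝓝 (ν.real A * ν.real B)) := by
  have hCm : ∀ A ∈ C, MeasurableSet A := fun A hA => by
    exact hgen.symm.le _ (MeasurableSpace.measurableSet_generateFrom hA)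
  have hpre : ∀ t {B : Set X}, MeasurableSet B → ν.real (θ t ⁻¹' B) = ν.real B :=
    fun t B hB => (hθ t).measureReal_preimage hB.nullMeasurableSet
  -- First extend in `A`, for `B` in the π-system; then extend in `B`, for `A` measurable.
  have step : ∀ B ∈ C, ∀ {A : Set X}, MeasurableSet A →
      Tendsto (fun t => ν.real (A ∩ θ t ⁻¹' B)) l (𝓝 (ν.real A * ν.real B)) := by
    intro B hB A hA
    have e : ∀ {A : Set X}, MeasurableSet A → ∀ t, (ν.restrict (θ t ⁻¹' B)).real A =
        ν.real (A ∩ θ t ⁻¹' B) := fun hA t => measureReal_restrict_apply hA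
    have := tendsto_measureReal_of_isPiSystem (ν := ν) (μ := fun t => ν.restrict (θ t ⁻¹' B))
      (fun t => Measure.restrict_le_self) (l := l) (c := ν.real B) hgen hC
      (by simp [hpre _ (hCm B hB), tendsto_const_nhds])
      (fun A hA => by
        simp_rw [e (hCm A hA), mul_comm (ν.real B)]
        exact h A hA B hB) hA
    simp_rw [e hA, mul_comm (ν.real B)] at this
    exact this
  have e : ∀ {B : Set X}, MeasurableSet B → ∀ t, ((ν.restrict A).map (θ t)).real B =
      ν.real (A ∩ θ t ⁻¹' B) := fun hB t => by
    rw [map_measureReal_apply (hθ t).measurable hB,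
      measureReal_restrict_apply ((hθ t).measurable hB), Set.inter_comm]
  have := tendsto_measureReal_of_isPiSystem (ν := ν) (μ := fun t => (ν.restrict A).map (θ t))
    (fun t => (Measure.map_mono Measure.restrict_le_self (hθ t).measurable).trans_eq (hθ t).map_eq)
    (l := l) (c := ν.real A) hgen hC
    (by simp_rw [e MeasurableSet.univ]; simp [tendsto_const_nhds])
    (fun B hB => by
      simp_rw [e (hCm B hB)]
      exact step B hB hA) hB
  simp_rw [e hB] at this
  exact this

/-! ### Factors of a stationary Poisson process -/

theorem volume_preimage_sub (t : Plane) (B : Set Plane) :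
    (volume : Measure Plane) ((fun x => x - t) ⁻¹' B) = volume B := by
  simp_rw [sub_eq_add_neg]
  exact measure_preimage_add_right volume (-t) B

section Poisson

variable {Ω : Type*} [MeasurableSpace Ω] {P : Measure Ω} [IsProbabilityMeasure P]
  {Φ : Ω → Config} {Λ : Measure Plane} [IsFiniteMeasureOnCompacts Λ]

theorem IsPoissonProcess.measurePreserving_shift (h : IsPoissonProcess P Φ Λ)
    (hΛ : ∀ t B, MeasurableSet B → Λ ((fun x => x - t) ⁻¹' B) = Λ B) (t : Plane) :
    MeasurePreserving (FollowerDynamics.shift t) (P.map Φ) (P.map Φ) := by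
  refine ⟨measurable_shift t, ?_⟩
  rw [Measure.map_map (measurable_shift t) h.1]
  exact (h.shift t (hΛ t)).map_eq h

/-- A stationary Poisson process is mixing, because events that are local to two disjoint windows
are independent. -/
theorem IsPoissonProcess.tendsto_inter_shift (h : IsPoissonProcess P Φ Λ)
    (hΛ : ∀ t B, MeasurableSet B → Λ ((fun x => x - t) ⁻¹' B) = Λ B) {A B : Set Config}
    (hA : MeasurableSet A) (hB : MeasurableSet B) :
    Tendsto (fun t => (P.map Φ).real (A ∩ FollowerDynamics.shift t ⁻¹' B))
      (Bornology.cobounded Plane) (𝓝 ((P.map Φ).real A * (P.map Φ).real B)) := by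
  have := Measure.isProbabilityMeasure_map (μ := P) h.1.aemeasurable
  have hpres := h.measurePreserving_shift hΛ
  refine tendsto_measureReal_inter_preimage hpres generateFrom_boundedEvents
    isPiSystem_boundedEvents (fun A hA B hB => ?_) hA hB
  obtain ⟨r, hr⟩ := Set.mem_iUnion.1 hA
  obtain ⟨s, hs⟩ := Set.mem_iUnion.1 hB
  have hball : ∀ u : ℕ, MeasurableSet (Metric.ball (0 : Plane) u) := fun u =>
    Metric.isOpen_ball.measurableSet
  have hpre : ∀ t : Plane, (fun x => x - t) ⁻¹' Metric.ball (0 : Plane) s = Metric.ball t s := by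
    intro t
    ext x
    simp [dist_eq_norm]
  -- Once the two windows are disjoint, the limit is attained.
  refine tendsto_const_nhds.congr' ?_
  filter_upwards [tendsto_norm_cobounded_atTop.eventually_ge_atTop ((r : ℝ) + s)] with t ht
  have hd : Disjoint (Metric.ball (0 : Plane) r) (Metric.ball t s) :=
    Metric.ball_disjoint_ball (by simpa using ht)
  have hBt := preimage_shift_mem_localEvents (hball s) hs t
  rw [hpre] at hBt
  rw [measureReal_def, measureReal_def, measureReal_def, h.map_inter_eq_mul Metric.isBounded_ball
    Metric.isBounded_ball (hball r) Metric.isOpen_ball.measurableSet hd hr hBt, ENNReal.toReal_mul,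
    (hpres t).measure_preimage (measurableSet_of_mem_localEvents (hball s) hs).nullMeasurableSet]

/-- Every factor of a stationary Poisson process is stationary and mixing. -/
theorem IsPoissonProcess.isMixingProcess_comp (h : IsPoissonProcess P Φ Λ)
    (hΛ : ∀ t B, MeasurableSet B → Λ ((fun x => x - t) ⁻¹' B) = Λ B) {F : Config → Config}
    (hF : Measurable F)
    (hFs : ∀ t φ, F (FollowerDynamics.shift t φ) = FollowerDynamics.shift t (F φ)) :
    IsMixingProcess P (F ∘ Φ) := by
  have hprob := Measure.isProbabilityMeasure_map (μ := P) h.1.aemeasurable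
  have hFm : MeasurePreserving F (P.map Φ) (P.map (F ∘ Φ)) :=
    ⟨hF, Measure.map_map hF h.1⟩
  have hcomm : ∀ t, FollowerDynamics.shift t ∘ F = F ∘ FollowerDynamics.shift t := fun t =>
    funext fun φ => (hFs t φ).symm
  have hprob' : IsProbabilityMeasure (P.map (F ∘ Φ)) :=
    Measure.isProbabilityMeasure_map (hF.comp h.1).aemeasurable
  refine ⟨hF.comp h.1, ⟨hprob', shift_zero, shift_add, measurable_shift_uncurry, fun t => ?_⟩,
    fun A B hA hB => ?_⟩
  · rw [← hFm.map_eq, Measure.map_map (measurable_shift t) hF, hcomm,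
      ← Measure.map_map hF (measurable_shift t), (h.measurePreserving_shift hΛ t).map_eq]
  · rw [← ENNReal.tendsto_toReal_iff (fun _ => measure_ne_top _ _)
      (ENNReal.mul_ne_top (measure_ne_top _ _) (measure_ne_top _ _)), ENNReal.toReal_mul]
    have := h.tendsto_inter_shift hΛ (hF hA) (hF hB)
    rw [hFm.measureReal_preimage hA.nullMeasurableSet,
      hFm.measureReal_preimage hB.nullMeasurableSet] at this
    refine this.congr fun t => ?_
    rw [shift_neg_image, ← measureReal_def,
      ← hFm.measureReal_preimage (hA.inter (measurable_shift t hB)).nullMeasurableSet,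
      Set.preimage_inter, ← Set.preimage_comp, ← Set.preimage_comp, hcomm]

end Poisson

end FollowerDynamics

theorem mainTheorem5 {Ω : Type*} [MeasurableSpace Ω] (P : MeasureTheory.Measure Ω)
    [MeasureTheory.IsProbabilityMeasure P] (lam : ℝ) (hlam : 0 < lam)
    (Φ : Ω → FollowerDynamics.Config)
    (hΦ : FollowerDynamics.IsPoissonProcess P Φ
      (ENNReal.ofReal lam • (MeasureTheory.volume : MeasureTheory.Measure FollowerDynamics.Plane)))
    (n : ℕ) :
    FollowerDynamics.IsFactor P Φ (FollowerDynamics.followerProcess Φ n) ∧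
      FollowerDynamics.IsMixingProcess P (FollowerDynamics.followerProcess Φ n) := by
  have hF := FollowerDynamics.measurable_followerStep_iterate n
  have hFs := FollowerDynamics.followerStep_iterate_shift n
  refine ⟨⟨_, hF, hFs, Eventually.of_forall fun _ => rfl⟩, ?_⟩
  have : IsFiniteMeasureOnCompacts
      (ENNReal.ofReal lam • (volume : Measure FollowerDynamics.Plane)) :=
    ⟨fun K hK => by
      rw [Measure.smul_apply, smul_eq_mul]
      exact ENNReal.mul_lt_top ENNReal.ofReal_lt_top hK.measure_lt_top⟩
  refine hΦ.isMixingProcess_comp (fun t B _ => ?_) hF hFs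
  rw [Measure.smul_apply, Measure.smul_apply, FollowerDynamics.volume_preimage_sub]
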